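/- Let $\mathbb E=\{(x_1,x_2,x_3)\in\mathbb C^3: 1-zx_1-wx_2+zwx_3\neq 0 \text{ whenever } |z|\le 1,\ |w|\le 1\}$ be the tetrablock. A commuting triple $(S_1,S_2,S_3)$ of bounded operators on a complex Hilbert space is an $\mathbb E$-contraction if its Taylor joint spectrum lies in $\overline{\mathbb E}$ and $\|p(S_1,S_2,S_3)\|\le\sup_{\overline{\mathbb E}}|p|$ for every polynomial $p$ in three variables; it is pure if moreover $(S_3^*)^n\to 0$ strongly. For a contraction $T$ put $D_T=(I-T^*T)^{1/2}$ and $\mathcal D_T=\overline{\operatorname{Ran}}\,D_T$. The fundamental operators of an $\mathbb E$-contraction $(S_1,S_2,S_3)$ are the (unique) bounded operators $F_1,F_2$ on $\mathcal D_{S_3}$ with $S_1-S_2^*S_3=D_{S_3}F_1D_{S_3}$ and $S_2-S_1^*S_3=D_{S_3}F_2D_{S_3}$. For a Hilbert space $E$, $H^2\otimes E$ is the $E$-valued Hardy space of the disc $\mathbb D$, i.e. the power series $\sum_{n\ge0}z^na_n$ with $a_n\in E$ and $\sum_n\|a_n\|^2<\infty$ ($z^n\otimes\xi$ being $z^n\xi$),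 and $M_z$ is multiplication by $z$. The characteristic function of a contraction $T$ is $$\Theta_T(z)=\bigl[-T+zD_{T^*}(I-zT^*)^{-1}D_T\bigr]\big|_{\mathcal D_T}:\mathcal D_T\to\mathcal D_{T^*}\qquad(z\in\mathbb D),$$ and $M_{\Theta_T}:H^2\otimes\mathcal D_T\to H^2\otimes\mathcal D_{T^*}$ is multiplication by it, $(M_{\Theta_T}f)(z)=\Theta_T(z)f(z)$. **Theorem.** Let $(T_1,T_2,T)$ be a pure $\mathbb E$-contraction on a complex Hilbert space $\mathcal H$, and suppose that the fundamental operators $A_{1*},A_{2*}$ of $(T_1^*,T_2^*,T^*)$ commute and satisfy $A_{1*}^*A_{1*}-A_{1*}A_{1*}^*=A_{2*}^*A_{2*}-A_{2*}A_{2*}^*$. Put $\mathbb H_T=(H^2\otimes\mathcal D_{T^*})\ominus M_{\Theta_T}(H^2\otimes\mathcal D_T)$ and $$R_1=P_{\mathbb H_T}(I\otimes A_{1*}^*+M_z\otimes A_{2*})|_{\mathbb H_T},\quad R_2=P_{\mathbb H_T}(I\otimes A_{2*}^*+M_z\otimes A_{1*})|_{\mathbb H_T},\quad R=P_{\mathbb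 H_T}(M_z\otimes I)|_{\mathbb H_T}.$$ Then $(T_1,T_2,T)$ is unitarily equivalent to $(R_1,R_2,R)$: there is a single unitary $U:\mathcal H\to\mathbb H_T$ with $UT_1=R_1U$, $UT_2=R_2U$ and $UT=RU$. -/

import Mathlib

open scoped InnerProduct Topology

noncomputable section

namespace Tetrablock

universe u v w

/-! ### The tetrablock and tetrablock contractions -/

/-- The tetrablock `𝔼 ⊆ ℂ³`. -/
def tetrablock : Set (Fin 3 → ℂ) :=
  {x | ∀ z w : ℂ, ‖z‖ ≤ 1 → ‖w‖ ≤ 1 → 1 - z * x 0 - w * x 1 + z * w * x 2 ≠ 0}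

section Operators

variable {H : Type u} [NormedAddCommGroup H] [InnerProductSpace ℂ H]

/-- The value `p(S₁, S₂, S₃)` of a polynomial in three variables at a (commuting) triple of
operators: `∑ₘ cₘ S₁^(m 0) S₂^(m 1) S₃^(m 2)`. -/
def polyEval (p : MvPolynomial (Fin 3) ℂ) (S₁ S₂ S₃ : H →L[ℂ] H) : H →L[ℂ] H :=
  ∑ m ∈ p.support, p.coeff m • (S₁ ^ m 0 * S₂ ^ m 1 * S₃ ^ m 2)

/-- Taylor regularity of a commuting triple: exactness of its Koszul complex
`0 → H → H³ → H³ → H → 0`, where the three maps are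
`x ↦ (S₁x, S₂x, S₃x)`,
`(x₁, x₂, x₃) ↦ (S₁x₂ - S₂x₁, S₁x₃ - S₃x₁, S₂x₃ - S₃x₂)` and
`(y₁, y₂, y₃) ↦ S₁y₃ - S₂y₂ + S₃y₁`. -/
structure TaylorRegular (S₁ S₂ S₃ : H →L[ℂ] H) : Prop where
  exact₀ : ∀ x, S₁ x = 0 → S₂ x = 0 → S₃ x = 0 → x = 0
  exact₁ : ∀ x₁ x₂ x₃, S₁ x₂ - S₂ x₁ = 0 → S₁ x₃ - S₃ x₁ = 0 → S₂ x₃ - S₃ x₂ = 0 →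
    ∃ x, S₁ x = x₁ ∧ S₂ x = x₂ ∧ S₃ x = x₃
  exact₂ : ∀ y₁ y₂ y₃, S₁ y₃ - S₂ y₂ + S₃ y₁ = 0 →
    ∃ x₁ x₂ x₃, S₁ x₂ - S₂ x₁ = y₁ ∧ S₁ x₃ - S₃ x₁ = y₂ ∧ S₂ x₃ - S₃ x₂ = y₃
  exact₃ : ∀ y, ∃ y₁ y₂ y₃, S₁ y₃ - S₂ y₂ + S₃ y₁ = y

/-- The Taylor joint spectrum of a commuting triple of operators. -/
def taylorSpectrum (S₁ S₂ S₃ : H →L[ℂ] H) : Set (Fin 3 → ℂ) :=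
  {l | ¬ TaylorRegular (S₁ - l 0 • ContinuousLinearMap.id ℂ H)
    (S₂ - l 1 • ContinuousLinearMap.id ℂ H) (S₃ - l 2 • ContinuousLinearMap.id ℂ H)}

/-- An `𝔼`-contraction: a commuting triple of operators having the closed tetrablock as a
spectral set. -/
structure IsEContraction (S₁ S₂ S₃ : H →L[ℂ] H) : Prop where
  commute₁₂ : Commute S₁ S₂
  commute₁₃ : Commute S₁ S₃
  commute₂₃ : Commute S₂ S₃
  spectrum_subset : taylorSpectrum S₁ S₂ S₃ ⊆ closure tetrablock
  norm_polyEval_le : ∀ p : MvPolynomial (Fin 3) ℂ,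
    ‖polyEval p S₁ S₂ S₃‖ ≤ sSup ((fun x => ‖MvPolynomial.eval x p‖) '' closure tetrablock)

/-- An `𝔼`-contraction is pure if the adjoints of the powers of its last entry tend to zero
strongly. -/
structure IsPureEContraction [CompleteSpace H] (S₁ S₂ S₃ : H →L[ℂ] H) : Prop
    extends IsEContraction S₁ S₂ S₃ where
  tendsto_adjoint_pow : ∀ h : H, Filter.Tendsto (fun n : ℕ => ((S₃†) ^ n) h) Filter.atTop (𝓝 0)

/-! ### Defect operators and fundamental operators -/

variable [CompleteSpace H]

/-- The defect operator `D_T = (I - T*T)^(1/2)` of a contraction. -/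
def defectOp (T : H →L[ℂ] H) : H →L[ℂ] H := CFC.sqrt (1 - T† * T)

/-- The defect space `𝒟_T`, the closure of the range of `D_T`. -/
abbrev defectSpace (T : H →L[ℂ] H) : Submodule ℂ H :=
  (LinearMap.range (defectOp T : H →ₗ[ℂ] H)).topologicalClosure

/-- `D_T` as an operator from `H` into `𝒟_T`. -/
def defectMap (T : H →L[ℂ] H) : H →L[ℂ] defectSpace T :=
  (defectOp T).codRestrict (defectSpace T) fun x =>
    Submodule.le_topologicalClosure _ (LinearMap.mem_range_self _ x)

/-- `A₁, A₂` are the fundamental operators of the triple `(S₁, S₂, S₃)`: they are operators on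
`𝒟_{S₃}` with `S₁ - S₂* S₃ = D_{S₃} A₁ D_{S₃}` and `S₂ - S₁* S₃ = D_{S₃} A₂ D_{S₃}`. -/
structure IsFundamentalPair (S₁ S₂ S₃ : H →L[ℂ] H)
    (A₁ A₂ : defectSpace S₃ →L[ℂ] defectSpace S₃) : Prop where
  eq₁ : S₁ - S₂† * S₃ = defectOp S₃ ∘L (defectSpace S₃).subtypeL ∘L A₁ ∘L defectMap S₃
  eq₂ : S₂ - S₁† * S₃ = defectOp S₃ ∘L (defectSpace S₃).subtypeL ∘L A₂ ∘L defectMap S₃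

end Operators

/-! ### Vector-valued Hardy spaces -/

/-- The Hardy space `H²(𝔻) ⊗ E` of `E`-valued functions on the disc: power series `∑ zⁿ aₙ` with
square summable coefficients `aₙ ∈ E` and norm `(∑ ‖aₙ‖²)^(1/2)`. An element is recorded by its
coefficient sequence; the elementary tensor `zⁿ ⊗ ξ` is the sequence that is `ξ` at place `n` and
`0` elsewhere. -/
abbrev Hardy (E : Type u) [NormedAddCommGroup E] : Type u := lp (fun _ : ℕ => E) 2

/-- The coefficients of `z f(z)`. -/
def shiftFun {E : Type u} [NormedAddCommGroup E] (f : ℕ → E) : ℕ → E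
  | 0 => 0
  | n + 1 => f n

lemma hasSum_shiftFun {E : Type u} [NormedAddCommGroup E] (f : Hardy E) :
    HasSum (fun n => ‖shiftFun f n‖ ^ (2 : ENNReal).toReal) (‖f‖ ^ (2 : ENNReal).toReal) := by
  have h := lp.hasSum_norm (p := 2) (by norm_num) f
  rw [← hasSum_nat_add_iff' 1]
  simpa [shiftFun] using h

section HardyOps

variable {E : Type u} [NormedAddCommGroup E] [InnerProductSpace ℂ E]
variable {F : Type v} [NormedAddCommGroup F] [InnerProductSpace ℂ F]

/-- The value at `z ∈ 𝔻` of an element of the Hardy space. -/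
def Hardy.eval (f : Hardy E) (z : ℂ) : E := ∑' n : ℕ, z ^ n • f n

/-- The operator `I ⊗ A`, which acts on coefficients by `aₙ ↦ A aₙ`. -/
def idTensor (A : E →L[ℂ] F) : Hardy E →L[ℂ] Hardy F :=
  lp.mapCLM (𝕜 := ℂ) 2 (fun _ : ℕ => A) (norm_nonneg A) fun _ => le_rfl

variable (E) in
/-- The operator `M_z ⊗ I`, multiplication by the coordinate function. -/
def shift : Hardy E →L[ℂ] Hardy E :=
  LinearMap.mkContinuous
    { toFun := fun f => ⟨shiftFun f, memℓp_gen (hasSum_shiftFun f).summable⟩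
      map_add' := by
        intro f g
        ext n
        change shiftFun (⇑f + ⇑g) n = shiftFun f n + shiftFun g n
        cases n <;> simp [shiftFun]
      map_smul' := by
        intro c f
        ext n
        change shiftFun (c • ⇑f) n = c • shiftFun f n
        cases n <;> simp [shiftFun] }
    1 (by
      intro f
      have h1 := lp.hasSum_norm (p := 2) (by norm_num)
        (⟨shiftFun f, memℓp_gen (hasSum_shiftFun f).summable⟩ : Hardy E)
      have h2 := h1.unique (hasSum_shiftFun f)
      rw [one_mul]
      exact ((Real.rpow_left_inj (norm_nonneg _) (norm_nonneg _) (by norm_num)).1 h2).le)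

/-- The operator `M_z ⊗ A`. -/
def shiftTensor (A : E →L[ℂ] F) : Hardy E →L[ℂ] Hardy F := shift F ∘L idTensor A

end HardyOps

/-! ### Multiplication operators -/

section Multiplier

variable {E : Type u} [NormedAddCommGroup E] [InnerProductSpace ℂ E] [CompleteSpace E]
variable {F : Type v} [NormedAddCommGroup F] [InnerProductSpace ℂ F] [CompleteSpace F]

lemma summable_of_bounded {a : ℕ → E} {C : ℝ} (ha : ∀ n, ‖a n‖ ≤ C) {z : ℂ} (hz : ‖z‖ < 1) :
    Summable fun n => z ^ n • a n := by
  refine Summable.of_norm_bounded ((summable_geometric_of_lt_one (norm_nonneg z) hz).mul_right C)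
    fun n => ?_
  rw [norm_smul, norm_pow]
  exact mul_le_mul_of_nonneg_left (ha n) (by positivity)

lemma Hardy.hasSum_eval (f : Hardy E) {z : ℂ} (hz : ‖z‖ < 1) :
    HasSum (fun n : ℕ => z ^ n • f n) (f.eval z) :=
  (summable_of_bounded (fun n => lp.norm_apply_le_norm (by norm_num) f n) hz).hasSum

lemma Hardy.eval_add (f g : Hardy E) {z : ℂ} (hz : ‖z‖ < 1) :
    Hardy.eval (f + g) z = f.eval z + g.eval z := by
  refine (Hardy.hasSum_eval (f + g) hz).unique ?_
  simpa [smul_add] using (f.hasSum_eval hz).add (g.hasSum_eval hz)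

lemma Hardy.eval_smul (c : ℂ) (f : Hardy E) {z : ℂ} (hz : ‖z‖ < 1) :
    Hardy.eval (c • f) z = c • f.eval z := by
  refine (Hardy.hasSum_eval (c • f) hz).unique ?_
  simpa [smul_comm _ c] using (f.hasSum_eval hz).const_smul c

/-- An element of the Hardy space is determined by its values on the disc. -/
lemma Hardy.ext_eval {f g : Hardy E} (h : ∀ z : ℂ, ‖z‖ < 1 → f.eval z = g.eval z) : f = g := by
  let p : FormalMultilinearSeries ℂ ℂ E := fun n =>
    ContinuousMultilinearMap.mkPiRing ℂ (Fin n) (f n - g n)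
  have hp : HasFPowerSeriesAt (0 : ℂ → E) p 0 := by
    rw [hasFPowerSeriesAt_iff]
    filter_upwards [Metric.ball_mem_nhds (0 : ℂ) one_pos] with z hz
    have hz' : ‖z‖ < 1 := by simpa using hz
    have := (f.hasSum_eval hz').sub (g.hasSum_eval hz')
    rw [h z hz', sub_self] at this
    simpa [p, FormalMultilinearSeries.coeff, smul_sub] using this
  have h0 := hp.eq_zero
  ext n
  have h1 : p.coeff n = 0 := by rw [h0]; rfl
  have h2 : p.coeff n = f n - g n := by simp [p, FormalMultilinearSeries.coeff]
  exact sub_eq_zero.1 (h2.symm.trans h1)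

/-- An operator-valued function on the disc is a multiplier if pointwise multiplication by it
maps the Hardy space into the Hardy space. -/
def IsMultiplier (Θ : ℂ → E →L[ℂ] F) : Prop :=
  ∀ f : Hardy E, ∃ g : Hardy F, ∀ z : ℂ, ‖z‖ < 1 → g.eval z = Θ z (f.eval z)

/-- The multiplication operator `M_Θ`, given by `(M_Θ f)(z) = Θ(z) f(z)` for `z ∈ 𝔻`. -/
def mulOp (Θ : ℂ → E →L[ℂ] F) (hΘ : IsMultiplier Θ) : Hardy E →ₗ[ℂ] Hardy F where
  toFun f := (hΘ f).choose
  map_add' f g := Hardy.ext_eval fun z hz => by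
    rw [(hΘ (f + g)).choose_spec z hz, Hardy.eval_add _ _ hz, Hardy.eval_add _ _ hz,
      (hΘ f).choose_spec z hz, (hΘ g).choose_spec z hz, map_add]
  map_smul' c f := Hardy.ext_eval fun z hz => by
    rw [(hΘ (c • f)).choose_spec z hz, RingHom.id_apply, Hardy.eval_smul _ _ hz,
      Hardy.eval_smul _ _ hz, (hΘ f).choose_spec z hz, map_smul]

lemma eval_mulOp (Θ : ℂ → E →L[ℂ] F) (hΘ : IsMultiplier Θ) (f : Hardy E) {z : ℂ}
    (hz : ‖z‖ < 1) : (mulOp Θ hΘ f).eval z = Θ z (f.eval z) :=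
  (hΘ f).choose_spec z hz

end Multiplier

/-! ### The characteristic function and the model space -/

section CharacteristicFunction

variable {H : Type u} [NormedAddCommGroup H] [InnerProductSpace ℂ H] [CompleteSpace H]

lemma semiconj_sqrt {A B X : H →L[ℂ] H} (hA : 0 ≤ A) (hB : 0 ≤ B) (h : X * A = B * X) :
    X * CFC.sqrt A = CFC.sqrt B * X := by
  have hpoly : ∀ q : Polynomial ℝ, X * Polynomial.aeval A q = Polynomial.aeval B q * X := by
    intro q
    have hpow : ∀ n : ℕ, X * A ^ n = B ^ n * X := fun n => by
      have : SemiconjBy X A B := h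
      exact this.pow_right n
    induction q using Polynomial.induction_on' with
    | add p q hp hq => simp [mul_add, add_mul, hp, hq]
    | monomial n a =>
      simp only [Polynomial.aeval_monomial, ← Algebra.smul_def, mul_smul_comm, smul_mul_assoc,
        hpow n]
  have hsq : ∀ C : H →L[ℂ] H, 0 ≤ C → CFC.sqrt C = cfc Real.sqrt C := fun C hC => by
    rw [CFC.sqrt_eq_real_sqrt C hC, cfcₙ_eq_cfc]
  rw [hsq A hA, hsq B hB]
  have hsA : IsSelfAdjoint A := .of_nonneg hA
  have hsB : IsSelfAdjoint B := .of_nonneg hB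
  obtain ⟨R, hR⟩ := ((spectrum.isCompact (𝕜 := ℝ) A).union
    (spectrum.isCompact (𝕜 := ℝ) B)).isBounded.subset_closedBall 0
  rw [Real.closedBall_eq_Icc] at hR
  rw [← sub_eq_zero, ← norm_le_zero_iff]
  refine le_of_forall_pos_le_add fun ε hε => ?_
  set δ := ε / (2 * (‖X‖ + 1)) with hδ
  have hX : 0 < 2 * (‖X‖ + 1) := by positivity
  have hδ0 : 0 < δ := by positivity
  obtain ⟨q, hq⟩ := exists_polynomial_near_of_continuousOn (0 - R) (0 + R) Real.sqrt
    Real.continuous_sqrt.continuousOn δ hδ0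
  have key : ∀ C : H →L[ℂ] H, IsSelfAdjoint C → spectrum ℝ C ⊆ Set.Icc (0 - R) (0 + R) →
      ‖cfc Real.sqrt C - Polynomial.aeval C q‖ ≤ δ := by
    intro C hC hs
    rw [← cfc_polynomial q C, ← cfc_sub _ _ C]
    refine norm_cfc_le hδ0.le fun x hx => ?_
    rw [Real.norm_eq_abs, abs_sub_comm]
    exact (hq x (hs hx)).le
  have kA := key A hsA (Set.subset_union_left.trans hR)
  have kB := key B hsB (Set.subset_union_right.trans hR)
  have e : X * cfc Real.sqrt A - cfc Real.sqrt B * X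
      = X * (cfc Real.sqrt A - Polynomial.aeval A q)
        - (cfc Real.sqrt B - Polynomial.aeval B q) * X := by
    rw [mul_sub, sub_mul, hpoly]; abel
  rw [e, zero_add]
  calc _ ≤ ‖X‖ * δ + δ * ‖X‖ := by
        refine (norm_sub_le _ _).trans (add_le_add ?_ ?_)
        · exact (norm_mul_le _ _).trans (mul_le_mul_of_nonneg_left kA (norm_nonneg _))
        · exact (norm_mul_le _ _).trans (mul_le_mul_of_nonneg_right kB (norm_nonneg _))
    _ ≤ δ * (2 * (‖X‖ + 1)) := by nlinarith
    _ = ε := by rw [hδ]; field_simp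

lemma defect_nonneg_iff (T : H →L[ℂ] H) : 0 ≤ 1 - T† * T ↔ ‖T‖ ≤ 1 := by
  rw [ContinuousLinearMap.nonneg_iff_isPositive, ContinuousLinearMap.isPositive_iff_complex]
  have key : ∀ x, inner ℂ ((1 - T† * T) x) x = ((‖x‖ ^ 2 - ‖T x‖ ^ 2 : ℝ) : ℂ) := by
    intro x
    simp [ContinuousLinearMap.adjoint_inner_left, inner_self_eq_norm_sq_to_K]
  constructor
  · intro h
    refine ContinuousLinearMap.opNorm_le_bound _ zero_le_one fun x => ?_
    have := (h x).2
    rw [key] at this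
    have h2 : 0 ≤ ‖x‖ ^ 2 - ‖T x‖ ^ 2 := this
    rw [one_mul]
    exact abs_le_of_sq_le_sq' (by linarith) (norm_nonneg _) |>.2
  · intro h x
    have h1 : ‖T x‖ ≤ ‖x‖ := by simpa using T.le_of_opNorm_le h x
    have h2 : 0 ≤ ‖x‖ ^ 2 - ‖T x‖ ^ 2 := by nlinarith [norm_nonneg (T x)]
    rw [key]
    exact ⟨rfl, h2⟩

lemma defectOp_nonneg (T : H →L[ℂ] H) : 0 ≤ defectOp T := CFC.sqrt_nonneg _

lemma defectOp_eq_zero {T : H →L[ℂ] H} (hT : ¬ ‖T‖ ≤ 1) : defectOp T = 0 := by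
  rw [← defect_nonneg_iff] at hT
  exact cfcₙ_apply_of_not_predicate _ hT

lemma defectOp_mul_self {T : H →L[ℂ] H} (hT : ‖T‖ ≤ 1) :
    defectOp T * defectOp T = 1 - T† * T :=
  CFC.sqrt_mul_sqrt_self _ ((defect_nonneg_iff T).2 hT)

/-- The relation `T D_T = D_{T*} T`. -/
lemma mul_defectOp (T : H →L[ℂ] H) : T * defectOp T = defectOp (T†) * T := by
  have hn : ‖T†‖ = ‖T‖ := LinearIsometryEquiv.norm_map _ T
  by_cases hT : ‖T‖ ≤ 1
  · refine semiconj_sqrt ((defect_nonneg_iff T).2 hT) ((defect_nonneg_iff _).2 (hn ▸ hT)) ?_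
    rw [ContinuousLinearMap.adjoint_adjoint, mul_sub, sub_mul, mul_one, one_mul, mul_assoc]
  · rw [defectOp_eq_zero hT, defectOp_eq_zero (hn.symm ▸ hT), mul_zero, zero_mul]

lemma map_defectSpace (T : H →L[ℂ] H) {x : H} (hx : x ∈ defectSpace T) :
    T x ∈ defectSpace (T†) := by
  refine map_mem_closure T.continuous hx ?_
  rintro _ ⟨y, rfl⟩
  exact ⟨T y, by simpa using (DFunLike.congr_fun (mul_defectOp T) y).symm⟩

/-- The characteristic function
`Θ_T(z) = [-T + z D_{T*} (I - z T*)⁻¹ D_T]|_{𝒟_T} : 𝒟_T → 𝒟_{T*}` of a contraction `T`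
(only its values at the points where `I - z T*` is invertible matter, in particular all `z ∈ 𝔻`). -/
def charFun (T : H →L[ℂ] H) (z : ℂ) : defectSpace T →L[ℂ] defectSpace (T†) :=
  ((-T + z • (defectOp (T†) * Ring.inverse (1 - z • T†) * defectOp T)) ∘L
    (defectSpace T).subtypeL).codRestrict (defectSpace (T†)) fun x => by
      refine add_mem (neg_mem (map_defectSpace T x.2)) (Submodule.smul_mem _ z ?_)
      exact Submodule.le_topologicalClosure _ (LinearMap.mem_range_self _ _)

/-- State sequence of the unitary colligation of `T` driven by the input sequence `f`. -/
def stateSeq (T : H →L[ℂ] H) (f : ℕ → H) : ℕ → H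
  | 0 => 0
  | n + 1 => (T†) (stateSeq T f n) + defectOp T (f n)

lemma defect_colligation {T : H →L[ℂ] H} (hT : ‖T‖ ≤ 1) (x u : H) :
    ‖(T†) x + defectOp T u‖ ^ 2 + ‖defectOp (T†) x - T u‖ ^ 2 = ‖x‖ ^ 2 + ‖u‖ ^ 2 := by
  have hn : ‖T†‖ = ‖T‖ := LinearIsometryEquiv.norm_map _ T
  have sa : ∀ (S : H →L[ℂ] H) (a b : H), inner ℂ (defectOp S a) b = inner ℂ a (defectOp S b) := by
    intro S a b
    have : (defectOp S)† = defectOp S := (IsSelfAdjoint.of_nonneg (defectOp_nonneg S))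
    conv_lhs => rw [← this]
    exact ContinuousLinearMap.adjoint_inner_left _ _ _
  have nD : ∀ (S : H →L[ℂ] H) (a : H), ‖S‖ ≤ 1 →
      ‖defectOp S a‖ ^ 2 = ‖a‖ ^ 2 - ‖S a‖ ^ 2 := by
    intro S a hS
    have h1 : defectOp S (defectOp S a) = a - (S†) (S a) := by
      simpa using DFunLike.congr_fun (defectOp_mul_self hS) a
    rw [← inner_self_eq_norm_sq (𝕜 := ℂ), sa, h1, inner_sub_right,
      ContinuousLinearMap.adjoint_inner_right, map_sub, inner_self_eq_norm_sq,
      inner_self_eq_norm_sq]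
  have cross : inner ℂ ((T†) x) (defectOp T u) = inner ℂ (defectOp (T†) x) (T u) := by
    rw [ContinuousLinearMap.adjoint_inner_left, sa]
    exact congrArg _ (DFunLike.congr_fun (mul_defectOp T) u)
  rw [norm_add_sq (𝕜 := ℂ), norm_sub_sq (𝕜 := ℂ), cross, nD T u hT, nD (T†) x (hn.symm ▸ hT)]
  ring

/-- The characteristic function is a multiplier. -/
theorem isMultiplier_charFun (T : H →L[ℂ] H) : IsMultiplier (charFun T) := by
  intro f
  by_cases hT : ‖T‖ ≤ 1
  swap
  · refine ⟨0, fun z _ => ?_⟩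
    have hn : ‖T†‖ = ‖T‖ := LinearIsometryEquiv.norm_map _ T
    have h0 : defectSpace (T†) = ⊥ := by
      rw [defectSpace, defectOp_eq_zero (hn.symm ▸ hT)]
      have h1 : LinearMap.range ((0 : H →L[ℂ] H) : H →ₗ[ℂ] H) = ⊥ := LinearMap.range_zero
      rw [h1]
      exact IsClosed.submodule_topologicalClosure_eq isClosed_singleton
    have : Subsingleton (defectSpace (T†)) := by rw [h0]; infer_instance
    exact Subsingleton.elim _ _
  have hn : ‖T†‖ ≤ 1 := by rwa [LinearIsometryEquiv.norm_map]
  set x : ℕ → H := stateSeq T fun n => (f n : H) with hx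
  have hx1 : ∀ n, x (n + 1) = (T†) (x n) + defectOp T (f n) := fun n => rfl
  let g : ℕ → defectSpace (T†) := fun n =>
    defectMap (T†) (x n) - ⟨T (f n), map_defectSpace T (f n).2⟩
  have hg : ∀ n, (g n : H) = defectOp (T†) (x n) - T (f n) := fun n => rfl
  have hf := lp.hasSum_norm (p := 2) (by norm_num) f
  simp only [ENNReal.toReal_ofNat, Real.rpow_ofNat] at hf
  have energy : ∀ N, ‖x N‖ ^ 2 + ∑ n ∈ Finset.range N, ‖g n‖ ^ 2
      = ∑ n ∈ Finset.range N, ‖f n‖ ^ 2 := by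
    intro N
    induction N with
    | zero => simp [hx, stateSeq]
    | succ N ih =>
      have h1 := defect_colligation hT (x N) (f N : H)
      rw [← hx1, ← hg] at h1
      rw [Finset.sum_range_succ, Finset.sum_range_succ, ← ih]
      simp only [Submodule.coe_norm] at h1 ⊢
      linarith
  have hle : ∀ N, ∑ n ∈ Finset.range N, ‖f n‖ ^ 2 ≤ ‖f‖ ^ 2 := fun N =>
    sum_le_hasSum _ (fun _ _ => by positivity) hf
  have hgs : Summable fun n => ‖g n‖ ^ 2 :=
    summable_of_sum_range_le (fun _ => by positivity) fun N =>
      (le_add_of_nonneg_left (by positivity)).trans ((energy N).le.trans (hle N))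
  have hxb : ∀ n, ‖x n‖ ≤ ‖f‖ := fun n => by
    have h1 : ‖x n‖ ^ 2 ≤ ‖f‖ ^ 2 :=
      (le_add_of_nonneg_right (by positivity)).trans ((energy n).le.trans (hle n))
    exact abs_le_of_sq_le_sq' h1 (norm_nonneg _) |>.2
  let G : Hardy (defectSpace (T†)) := ⟨g, memℓp_gen (by simpa using hgs)⟩
  refine ⟨G, fun z hz => ?_⟩
  have hX := (summable_of_bounded hxb hz).hasSum
  set X : H := ∑' n, z ^ n • x n
  have hF : HasSum (fun n : ℕ => z ^ n • (f n : H)) (f.eval z : H) := by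
    simpa using (f.hasSum_eval hz).mapL (defectSpace T).subtypeL
  have hG : HasSum (fun n : ℕ => z ^ n • (g n : H)) (G.eval z : H) := by
    simpa using (G.hasSum_eval hz).mapL (defectSpace (T†)).subtypeL
  have hX2 : X = z • ((T†) X + defectOp T (f.eval z)) := by
    have h1 := ((hX.mapL (T†)).add (hF.mapL (defectOp T))).const_smul z
    have h2 : HasSum (fun n : ℕ => z ^ (n + 1) • x (n + 1)) X := by
      rw [hasSum_nat_add_iff (f := fun n => z ^ n • x n) 1]
      simpa [hx, stateSeq] using hX
    refine h2.unique (h1.congr_fun ?_)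
    intro n
    simp only [hx1, map_smul, ← smul_add, smul_smul, pow_succ']
  have hu : IsUnit (1 - z • T†) := by
    refine isUnit_one_sub_of_norm_lt_one ?_
    rw [norm_smul]
    calc ‖z‖ * ‖T†‖ ≤ ‖z‖ * 1 := mul_le_mul_of_nonneg_left hn (norm_nonneg _)
      _ < 1 := by simpa using hz
  have hX3 : X = z • (Ring.inverse (1 - z • T†)) (defectOp T (f.eval z)) := by
    have h1 : (1 - z • T†) X = z • defectOp T (f.eval z) := by
      change X - z • (T†) X = z • defectOp T (f.eval z)
      nth_rewrite 1 [hX2]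
      rw [smul_add]; abel
    rw [← map_smul, ← h1]
    exact (DFunLike.congr_fun (Ring.inverse_mul_cancel _ hu) X).symm
  apply Subtype.ext
  refine hG.unique ?_
  have h1 := (hX.mapL (defectOp (T†))).sub (hF.mapL T)
  have e : ((charFun T z (f.eval z) : defectSpace (T†)) : H)
      = defectOp (T†) X - T (f.eval z) := by
    rw [hX3]
    simp [charFun]
    abel
  rw [e]
  refine h1.congr_fun fun n => ?_
  simp [hg, smul_sub]

/-- The model space `(H² ⊗ 𝒟_{T*}) ⊖ M_{Θ_T}(H² ⊗ 𝒟_T)`. -/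
abbrev modelSpace (T : H →L[ℂ] H) : Submodule ℂ (Hardy (defectSpace (T†))) :=
  (LinearMap.range (mulOp (charFun T) (isMultiplier_charFun T)))ᗮ

end CharacteristicFunction

/-- The compression `P_M S|_M` of an operator to a closed subspace. -/
def compression {K : Type u} [NormedAddCommGroup K] [InnerProductSpace ℂ K]
    (M : Submodule ℂ K) [M.HasOrthogonalProjection] (S : K →L[ℂ] K) : M →L[ℂ] M :=
  M.orthogonalProjectionOnto ∘L S ∘L M.subtypeL

/-- Unitary equivalence of triples of operators. -/
def TripleUnitarilyEquivalent {H : Type u} [NormedAddCommGroup H] [InnerProductSpace ℂ H]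
    {K : Type v} [NormedAddCommGroup K] [InnerProductSpace ℂ K]
    (S₁ S₂ S₃ : H →L[ℂ] H) (R₁ R₂ R₃ : K →L[ℂ] K) : Prop :=
  ∃ U : H ≃ₗᵢ[ℂ] K, (∀ h, U (S₁ h) = R₁ (U h)) ∧ (∀ h, U (S₂ h) = R₂ (U h)) ∧
    (∀ h, U (S₃ h) = R₃ (U h))

end Tetrablock

end

open Tetrablock

noncomputable section

namespace Tetrablock

universe u v

/-! ### The last entry of a tetrablock contraction is a contraction -/

/-! The unitary comes from `observability` for `T*`: `W x = ∑ zⁿ D_{T*} T*ⁿ x`. Since `‖D_{T*} y‖² =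
‖y‖² - ‖T* y‖²`, the coefficient norms telescope, and purity makes `W` isometric. That `T` is a
contraction follows from the spectral set inequality for the third coordinate polynomial, which has
modulus at most one on the closed tetrablock.

The range of `W` is exactly the model space. The operator matrix `(T*, D_T; D_{T*}, -T)` is unitary,
and `M_Θ` sends an input sequence to the output sequence of this colligation started at state zero
(`mulOp_charFun_apply`). Pairing outputs with `W x` telescopes to a boundary term that purity kills
(`observability_mem_modelSpace`). Conversely, for `g` in the model space, the vectors obtained by
applying `W*` to the tails of `g` form a trajectory of `T*` whose outputs are the coefficients of
`g` (`exists_observability_eq`).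

The operators are matched on the adjoint side. The defining equations of the fundamental operators
give `D T₁* = A₁ D + A₂* D T*` with `D = D_{T*}` (`IsFundamentalPair.defectMap_apply`). Read
coefficientwise, this is `W T₁* = (I ⊗ A₁* + M_z ⊗ A₂)* W`; taking adjoints gives the compression
formula for `T₁`. Exchanging the indices gives `T₂`, and the pair `(0, I)` gives `T`. -/

/-- For fixed `z` the defining form is affine in `w`, so failure of the inequality would place a
root `w` in the closed disc. -/
lemma norm_sub_lt_of_mem_tetrablock {x : Fin 3 → ℂ} (hx : x ∈ tetrablock) {z : ℂ} (hz : ‖z‖ ≤ 1) :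
    ‖x 1 - z * x 2‖ < ‖1 - z * x 0‖ := by
  by_contra! h
  by_cases h0 : x 1 - z * x 2 = 0
  · refine hx z 0 hz (by simp) ?_
    rw [h0, norm_zero, norm_le_zero_iff] at h
    linear_combination h
  · refine hx z ((1 - z * x 0) / (x 1 - z * x 2)) hz ?_ ?_
    · rw [norm_div]
      exact div_le_one_of_le₀ h (norm_nonneg _)
    · field_simp
      ring

/-- Squaring the previous inequality at `z = 1` and `z = -1` and adding removes the cross terms, by
the parallelogram law. -/
lemma norm_sq_add_lt_of_mem_tetrablock {x : Fin 3 → ℂ} (hx : x ∈ tetrablock) :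
    ‖x 1‖ ^ 2 + ‖x 2‖ ^ 2 < 1 + ‖x 0‖ ^ 2 := by
  have h1 := norm_sub_lt_of_mem_tetrablock hx (z := 1) (by simp)
  have h2 := norm_sub_lt_of_mem_tetrablock hx (z := -1) (by simp)
  simp only [one_mul, neg_mul, sub_neg_eq_add] at h1 h2
  have p1 := parallelogram_law_with_norm ℂ (x 1) (x 2)
  have p2 := parallelogram_law_with_norm ℂ (1 : ℂ) (x 0)
  rw [norm_one] at p2
  nlinarith [norm_nonneg (x 1 - x 2), norm_nonneg (x 1 + x 2)]

lemma swap_mem_tetrablock {x : Fin 3 → ℂ} (hx : x ∈ tetrablock) :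
    ![x 1, x 0, x 2] ∈ tetrablock := by
  intro z w hz hw h
  refine hx w z hw hz ?_
  simp at h
  linear_combination h

/-- The bound is a closed condition, so it suffices to check it on the tetrablock. There, adding the
quadratic inequality to its image under the swap of the first two coordinates cancels both of them.
-/
lemma norm_apply_two_le_one {x : Fin 3 → ℂ} (hx : x ∈ closure tetrablock) : ‖x 2‖ ≤ 1 := by
  refine closure_minimal (t := {y : Fin 3 → ℂ | ‖y 2‖ ≤ 1}) (fun y hy => ?_)
    (isClosed_le (by fun_prop) continuous_const) hx
  have h1 := norm_sq_add_lt_of_mem_tetrablock hy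
  have h2 := norm_sq_add_lt_of_mem_tetrablock (swap_mem_tetrablock hy)
  simp at h2
  have h3 : ‖y 2‖ ^ 2 ≤ 1 := by linarith
  exact (sq_le_one_iff₀ (norm_nonneg _)).1 h3

section Operators

variable {H : Type u} [NormedAddCommGroup H] [InnerProductSpace ℂ H]

lemma polyEval_X_two (S₁ S₂ S₃ : H →L[ℂ] H) : polyEval (MvPolynomial.X 2) S₁ S₂ S₃ = S₃ := by
  simp [polyEval, MvPolynomial.support_X]

lemma IsEContraction.norm_le_one {S₁ S₂ S₃ : H →L[ℂ] H} (hS : IsEContraction S₁ S₂ S₃) :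
    ‖S₃‖ ≤ 1 := by
  have h := hS.norm_polyEval_le (MvPolynomial.X 2)
  rw [polyEval_X_two] at h
  refine h.trans (Real.sSup_le ?_ zero_le_one)
  rintro _ ⟨x, hx, rfl⟩
  simpa using norm_apply_two_le_one hx

variable [CompleteSpace H]

/-! ### The defect map -/

lemma defectOp_adjoint (T : H →L[ℂ] H) : (defectOp T)† = defectOp T :=
  IsSelfAdjoint.of_nonneg (defectOp_nonneg T)

lemma coe_defectMap (T : H →L[ℂ] H) (x : H) : (defectMap T x : H) = defectOp T x := rfl

lemma defectMap_adjoint (T : H →L[ℂ] H) :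
    (defectMap T)† = defectOp T ∘L (defectSpace T).subtypeL := by
  symm
  rw [ContinuousLinearMap.eq_adjoint_iff]
  intro x y
  change inner ℂ (defectOp T (x : H)) y = inner ℂ (x : H) (defectOp T y)
  conv_rhs => rw [← ContinuousLinearMap.adjoint_inner_left, defectOp_adjoint]

lemma defectMap_adjoint_apply (T : H →L[ℂ] H) (x : defectSpace T) :
    ((defectMap T)†) x = defectOp T x := by
  rw [defectMap_adjoint]; rfl

lemma inner_defectMap (T : H →L[ℂ] H) (x : H) (y : defectSpace T) :
    inner ℂ (defectMap T x) y = inner ℂ x (defectOp T y) := by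
  rw [← defectMap_adjoint_apply, ContinuousLinearMap.adjoint_inner_right]

lemma inner_defectOp (T : H →L[ℂ] H) (x y : H) :
    inner ℂ (defectOp T x) y = inner ℂ x (defectOp T y) := by
  rw [← ContinuousLinearMap.adjoint_inner_right, defectOp_adjoint]

lemma defectOp_defectOp {T : H →L[ℂ] H} (hT : ‖T‖ ≤ 1) (x : H) :
    defectOp T (defectOp T x) = x - (T†) (T x) := by
  simpa using DFunLike.congr_fun (defectOp_mul_self hT) x

/-- `D_T` is injective on the defect space. -/
lemma eq_of_defectOp_eq {T : H →L[ℂ] H} {x y : defectSpace T}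
    (h : defectOp T x = defectOp T y) : x = y := by
  rw [← sub_eq_zero]
  apply Subtype.ext
  have h1 : defectOp T ((x - y : defectSpace T) : H) = 0 := by simp [h]
  have h2 : ((x - y : defectSpace T) : H) ∈ (defectSpace T)ᗮ := by
    refine (Submodule.orthogonal_closure _).ge ?_
    rw [Submodule.mem_orthogonal]
    rintro _ ⟨u, rfl⟩
    change inner ℂ (defectOp T u) _ = 0
    rw [inner_defectOp, h1, inner_zero_right]
  have h3 := Submodule.inner_right_of_mem_orthogonal (x - y).2 h2
  exact inner_self_eq_zero.1 h3

lemma IsFundamentalPair.symm {S₁ S₂ S₃ : H →L[ℂ] H} {A₁ A₂ : defectSpace S₃ →L[ℂ] defectSpace S₃}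
    (hA : IsFundamentalPair S₁ S₂ S₃ A₁ A₂) : IsFundamentalPair S₂ S₁ S₃ A₂ A₁ :=
  ⟨hA.eq₂, hA.eq₁⟩

/-- The relation `D S₁ = A₁ D + A₂* D S₃` for the fundamental operators, with `D = D_{S₃}`. -/
lemma IsFundamentalPair.defectMap_apply {S₁ S₂ S₃ : H →L[ℂ] H}
    {A₁ A₂ : defectSpace S₃ →L[ℂ] defectSpace S₃} (hA : IsFundamentalPair S₁ S₂ S₃ A₁ A₂)
    (h₁₃ : Commute S₁ S₃) (hS : ‖S₃‖ ≤ 1) (x : H) :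
    defectMap S₃ (S₁ x) = A₁ (defectMap S₃ x) + (A₂†) (defectMap S₃ (S₃ x)) := by
  -- After applying the injective `D`, the two terms on the right become `S₁ - S₂* S₃` and `(S₂* -
  -- S₃* S₁) S₃`. Their sum is `(I - S₃* S₃) S₁` because `S₁` and `S₃` commute.
  apply eq_of_defectOp_eq
  have e1 : defectOp S₃ (A₁ (defectMap S₃ x)) = S₁ x - (S₂†) (S₃ x) :=
    (DFunLike.congr_fun hA.eq₁ x).symm
  have e2 : defectOp S₃ ((A₂†) (defectMap S₃ (S₃ x))) = (S₂†) (S₃ x) - (S₃†) (S₁ (S₃ x)) := by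
    rw [← defectMap_adjoint_apply]
    refine ext_inner_right ℂ fun y => ?_
    have h : S₂ y - (S₁†) (S₃ y) = defectOp S₃ (A₂ (defectMap S₃ y)) :=
      DFunLike.congr_fun hA.eq₂ y
    rw [ContinuousLinearMap.adjoint_inner_left, ContinuousLinearMap.adjoint_inner_left,
      ← ContinuousLinearMap.adjoint_inner_right, defectMap_adjoint_apply]
    rw [← h, inner_sub_right, inner_sub_left,
      ContinuousLinearMap.adjoint_inner_right, ContinuousLinearMap.adjoint_inner_left,
      ContinuousLinearMap.adjoint_inner_left]
  have e3 : S₁ (S₃ x) = S₃ (S₁ x) := DFunLike.congr_fun h₁₃.eq x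
  rw [coe_defectMap, defectOp_defectOp hS, Submodule.coe_add, map_add, e1, e2, e3]
  abel

lemma adjoint_map_defectSpace (T : H →L[ℂ] H) {x : H} (hx : x ∈ defectSpace (T†)) :
    (T†) x ∈ defectSpace T := by
  simpa using map_defectSpace (T†) hx

lemma adjoint_defectOp (T : H →L[ℂ] H) (x : H) :
    (T†) (defectOp (T†) x) = defectOp T ((T†) x) := by
  simpa using DFunLike.congr_fun (mul_defectOp (T†)) x

end Operators

/-! ### Coefficients and tails in the Hardy space -/

section HardyOps

variable {E : Type u} [NormedAddCommGroup E] [InnerProductSpace ℂ E]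
variable {F : Type v} [NormedAddCommGroup F] [InnerProductSpace ℂ F]

lemma Hardy.hasSum_norm_sq {E : Type u} [NormedAddCommGroup E] (f : Hardy E) :
    HasSum (fun n => ‖f n‖ ^ 2) (‖f‖ ^ 2) := by
  simpa using lp.hasSum_norm (p := 2) (by norm_num) f

lemma idTensor_apply (A : E →L[ℂ] F) (f : Hardy E) (n : ℕ) : idTensor A f n = A (f n) := rfl

lemma shiftTensor_apply_zero (A : E →L[ℂ] F) (f : Hardy E) : shiftTensor A f 0 = 0 := rfl

/-- The element of the Hardy space with coefficients `a_k, a_{k+1}, …`. -/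
def Hardy.drop {E : Type u} [NormedAddCommGroup E] (k : ℕ) (f : Hardy E) : Hardy E :=
  ⟨fun n => f (n + k), memℓp_gen (by
    simpa using (summable_nat_add_iff k).2 f.hasSum_norm_sq.summable)⟩

@[simp] lemma Hardy.drop_apply {E : Type u} [NormedAddCommGroup E] (k : ℕ) (f : Hardy E) (n : ℕ) :
    f.drop k n = f (n + k) := rfl

lemma Hardy.hasSum_inner (f g : Hardy E) : HasSum (fun n => inner ℂ (f n) (g n)) (inner ℂ f g) :=
  lp.hasSum_inner f g

/-- This splitting stands in for the adjoint of `M_z`, the backward shift `Hardy.drop 1`. -/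
lemma Hardy.inner_eq_add_drop (f g : Hardy E) :
    inner ℂ f g = inner ℂ (f 0) (g 0) + inner ℂ (f.drop 1) (g.drop 1) := by
  have h := (hasSum_nat_add_iff (f := fun n => inner ℂ (f n) (g n)) 1).1
    (Hardy.hasSum_inner (f.drop 1) (g.drop 1))
  rw [Finset.sum_range_one] at h
  rw [(Hardy.hasSum_inner f g).unique h, add_comm]

end HardyOps

/-! ### Compressions and weak intertwining -/

lemma inner_compression {K : Type u} [NormedAddCommGroup K] [InnerProductSpace ℂ K]
    (M : Submodule ℂ K) [M.HasOrthogonalProjection] (S : K →L[ℂ] K) (v w : M) :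
    inner ℂ v (compression M S w) = inner ℂ (v : K) (S w) :=
  Submodule.inner_orthogonalProjectionOnto_eq_of_mem_left _ _

/-- A unitary `U` onto `M` intertwines `B` with the compression of `S` to `M` if it does so in the
weak sense. -/
lemma map_eq_compression {H : Type v} [NormedAddCommGroup H] [InnerProductSpace ℂ H]
    {K : Type u} [NormedAddCommGroup K] [InnerProductSpace ℂ K]
    (M : Submodule ℂ K) [M.HasOrthogonalProjection] (S : K →L[ℂ] K) (U : H ≃ₗᵢ[ℂ] M)
    {B : H →L[ℂ] H} (h : ∀ x y, inner ℂ (U y : K) (S (U x)) = inner ℂ y (B x)) (x : H) :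
    U (B x) = compression M S (U x) := by
  refine ext_inner_left ℂ fun v => ?_
  obtain ⟨y, rfl⟩ := U.surjective v
  rw [LinearIsometryEquiv.inner_map_map, inner_compression, h]

section Model

variable {H : Type u} [NormedAddCommGroup H] [InnerProductSpace ℂ H] [CompleteSpace H]

/-! ### The canonical isometry into the Hardy space -/

lemma norm_defectMap_sq {S : H →L[ℂ] H} (hS : ‖S‖ ≤ 1) (x : H) :
    ‖defectMap S x‖ ^ 2 = ‖x‖ ^ 2 - ‖S x‖ ^ 2 := by
  rw [← inner_self_eq_norm_sq (𝕜 := ℂ), ← ContinuousLinearMap.adjoint_inner_right,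
    defectMap_adjoint_apply, coe_defectMap, defectOp_defectOp hS, inner_sub_right,
    ContinuousLinearMap.adjoint_inner_right, map_sub, inner_self_eq_norm_sq,
    inner_self_eq_norm_sq]

/-- The partial sums telescope to `‖x‖² - ‖Sᴺ x‖²`. -/
lemma hasSum_norm_defectMap_pow {S : H →L[ℂ] H} (hS : ‖S‖ ≤ 1) {x : H}
    (hx : Filter.Tendsto (fun n : ℕ => (S ^ n) x) Filter.atTop (𝓝 0)) :
    HasSum (fun n : ℕ => ‖defectMap S ((S ^ n) x)‖ ^ 2) (‖x‖ ^ 2) := by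
  rw [hasSum_iff_tendsto_nat_of_nonneg fun n => by positivity]
  have h : ∀ N, ∑ n ∈ Finset.range N, ‖defectMap S ((S ^ n) x)‖ ^ 2
      = ‖x‖ ^ 2 - ‖(S ^ N) x‖ ^ 2 := by
    intro N
    induction N with
    | zero => simp
    | succ N ih =>
      rw [Finset.sum_range_succ, ih, norm_defectMap_sq hS, pow_succ' S N]
      change _ = _ - ‖S ((S ^ N) x)‖ ^ 2
      ring
  simp only [h]
  simpa using (hx.norm.pow 2).const_sub (‖x‖ ^ 2)

/-- The isometry `x ↦ ∑ zⁿ D_S Sⁿ x` of a contraction `S` whose powers tend to zero strongly. -/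
def observability (S : H →L[ℂ] H) (hS : ‖S‖ ≤ 1)
    (h0 : ∀ x : H, Filter.Tendsto (fun n : ℕ => (S ^ n) x) Filter.atTop (𝓝 0)) :
    H →ₗᵢ[ℂ] Hardy (defectSpace S) where
  toFun x := ⟨fun n => defectMap S ((S ^ n) x), memℓp_gen (by
    simpa using (hasSum_norm_defectMap_pow hS (h0 x)).summable)⟩
  map_add' x y := lp.ext (funext fun n => ((defectMap S).comp (S ^ n)).map_add x y)
  map_smul' c x := lp.ext (funext fun n => ((defectMap S).comp (S ^ n)).map_smul c x)
  norm_map' x := by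
    refine (sq_eq_sq₀ (norm_nonneg _) (norm_nonneg _)).1 ?_
    exact (Hardy.hasSum_norm_sq _).unique (hasSum_norm_defectMap_pow hS (h0 x))

section Observability

variable {S : H →L[ℂ] H} {hS : ‖S‖ ≤ 1}
  {h0 : ∀ x : H, Filter.Tendsto (fun n : ℕ => (S ^ n) x) Filter.atTop (𝓝 0)}

lemma observability_apply (x : H) (n : ℕ) :
    observability S hS h0 x n = defectMap S ((S ^ n) x) := rfl

lemma observability_apply_zero (x : H) : observability S hS h0 x 0 = defectMap S x := rfl

lemma observability_drop_one (x : H) :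
    (observability S hS h0 x).drop 1 = observability S hS h0 (S x) := by
  ext n
  simp only [Hardy.drop_apply, observability_apply, pow_succ]
  rfl

/-- If `D B = A₁ D + A₂* D S`, then `W B = (I ⊗ A₁* + M_z ⊗ A₂)* W` for the isometry `W`. -/
lemma inner_observability_pencil {A₁ A₂ : defectSpace S →L[ℂ] defectSpace S} {B : H →L[ℂ] H}
    (hB : Commute B S)
    (h : ∀ x, defectMap S (B x) = A₁ (defectMap S x) + (A₂†) (defectMap S (S x)))
    (x : H) (f : Hardy (defectSpace S)) :
    inner ℂ (observability S hS h0 x) ((idTensor (A₁†) + shiftTensor A₂) f)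
      = inner ℂ (observability S hS h0 (B x)) f := by
  set W := observability S hS h0
  have e1 := Hardy.hasSum_inner (W x) (idTensor (A₁†) f)
  -- The shift moves across the inner product as the backward shift, which acts on the range of `W`
  -- as `S`.
  have e2 : inner ℂ (W x) (shiftTensor A₂ f) = inner ℂ (W (S x)) (idTensor A₂ f) := by
    rw [Hardy.inner_eq_add_drop, observability_drop_one, shiftTensor_apply_zero, inner_zero_right,
      zero_add]
    rfl
  have e3 := Hardy.hasSum_inner (W (S x)) (idTensor A₂ f)
  rw [← e2] at e3
  have e4 := e1.add e3
  rw [← inner_add_right] at e4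
  refine e4.unique ((Hardy.hasSum_inner (W (B x)) f).congr_fun fun n => ?_)
  have hn : (S ^ n) (B x) = B ((S ^ n) x) := (DFunLike.congr_fun (hB.pow_right n).eq x).symm
  have hn' : (S ^ n) (S x) = S ((S ^ n) x) :=
    DFunLike.congr_fun ((Commute.refl S).pow_left n).eq x
  simp only [idTensor_apply, W, observability_apply]
  rw [hn, h, hn', inner_add_left, ContinuousLinearMap.adjoint_inner_left,
    ContinuousLinearMap.adjoint_inner_right]

end Observability

/-! ### The model space is the range of the canonical isometry -/

/-- The coefficients of `M_{Θ_T} f` are the outputs of the unitary colligation of `T` driven by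
the coefficients of `f`. -/
lemma mulOp_charFun_apply {T : H →L[ℂ] H} (hT : ‖T‖ ≤ 1) (f : Hardy (defectSpace T)) :
    (∀ n, ‖stateSeq T (fun n => (f n : H)) n‖ ≤ ‖f‖) ∧
    ∀ n, (mulOp (charFun T) (isMultiplier_charFun T) f n : H)
      = defectOp (T†) (stateSeq T (fun n => (f n : H)) n) - T (f n) := by
  have hn : ‖T†‖ ≤ 1 := by rwa [LinearIsometryEquiv.norm_map]
  set x : ℕ → H := stateSeq T fun n => (f n : H) with hx
  have hx1 : ∀ n, x (n + 1) = (T†) (x n) + defectOp T (f n) := fun n => rfl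
  let g : ℕ → defectSpace (T†) := fun n =>
    defectMap (T†) (x n) - ⟨T (f n), map_defectSpace T (f n).2⟩
  have hg : ∀ n, (g n : H) = defectOp (T†) (x n) - T (f n) := fun n => rfl
  -- Unitarity of the colligation conserves energy, which bounds the states and makes the outputs
  -- square summable.
  have energy : ∀ N, ‖x N‖ ^ 2 + ∑ n ∈ Finset.range N, ‖g n‖ ^ 2
      = ∑ n ∈ Finset.range N, ‖f n‖ ^ 2 := by
    intro N
    induction N with
    | zero => simp [hx, stateSeq]
    | succ N ih =>
      have h1 := defect_colligation hT (x N) (f N : H)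
      rw [← hx1, ← hg] at h1
      rw [Finset.sum_range_succ, Finset.sum_range_succ, ← ih]
      simp only [Submodule.coe_norm] at h1 ⊢
      linarith
  have hle : ∀ N, ∑ n ∈ Finset.range N, ‖f n‖ ^ 2 ≤ ‖f‖ ^ 2 := fun N =>
    sum_le_hasSum _ (fun _ _ => by positivity) f.hasSum_norm_sq
  have hgs : Summable fun n => ‖g n‖ ^ 2 :=
    summable_of_sum_range_le (fun _ => by positivity) fun N =>
      (le_add_of_nonneg_left (by positivity)).trans ((energy N).le.trans (hle N))
  have hxb : ∀ n, ‖x n‖ ≤ ‖f‖ := fun n => by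
    have h1 : ‖x n‖ ^ 2 ≤ ‖f‖ ^ 2 :=
      (le_add_of_nonneg_right (by positivity)).trans ((energy n).le.trans (hle n))
    exact abs_le_of_sq_le_sq' h1 (norm_nonneg _) |>.2
  let G : Hardy (defectSpace (T†)) := ⟨g, memℓp_gen (by simpa using hgs)⟩
  refine ⟨hxb, fun n => ?_⟩
  rw [← hg n]
  suffices hmul : mulOp (charFun T) (isMultiplier_charFun T) f = G by rw [hmul]
  refine Hardy.ext_eval fun z hz => ?_
  rw [eval_mulOp _ _ _ hz]
  have hX := (summable_of_bounded hxb hz).hasSum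
  set X : H := ∑' n, z ^ n • x n
  have hF : HasSum (fun n : ℕ => z ^ n • (f n : H)) (f.eval z : H) := by
    simpa using (f.hasSum_eval hz).mapL (defectSpace T).subtypeL
  have hG : HasSum (fun n : ℕ => z ^ n • (g n : H)) (G.eval z : H) := by
    simpa using (G.hasSum_eval hz).mapL (defectSpace (T†)).subtypeL
  -- The generating function of the states inherits the state recursion; no constant term appears
  -- since the initial state is zero.
  have hX2 : X = z • ((T†) X + defectOp T (f.eval z)) := by
    have h1 := ((hX.mapL (T†)).add (hF.mapL (defectOp T))).const_smul z
    have h2 : HasSum (fun n : ℕ => z ^ (n + 1) • x (n + 1)) X := by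
      rw [hasSum_nat_add_iff (f := fun n => z ^ n • x n) 1]
      simpa [hx, stateSeq] using hX
    refine h2.unique (h1.congr_fun ?_)
    intro n
    simp only [hx1, map_smul, ← smul_add, smul_smul, pow_succ']
  have hu : IsUnit (1 - z • T†) := by
    refine isUnit_one_sub_of_norm_lt_one ?_
    rw [norm_smul]
    calc ‖z‖ * ‖T†‖ ≤ ‖z‖ * 1 := mul_le_mul_of_nonneg_left hn (norm_nonneg _)
      _ < 1 := by simpa using hz
  have hX3 : X = z • (Ring.inverse (1 - z • T†)) (defectOp T (f.eval z)) := by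
    have h1 : (1 - z • T†) X = z • defectOp T (f.eval z) := by
      change X - z • (T†) X = z • defectOp T (f.eval z)
      nth_rewrite 1 [hX2]
      rw [smul_add]; abel
    rw [← map_smul, ← h1]
    exact (DFunLike.congr_fun (Ring.inverse_mul_cancel _ hu) X).symm
  apply Subtype.ext
  symm
  refine hG.unique ?_
  have h1 := (hX.mapL (defectOp (T†))).sub (hF.mapL T)
  have e : ((charFun T z (f.eval z) : defectSpace (T†)) : H)
      = defectOp (T†) X - T (f.eval z) := by
    rw [hX3]
    simp [charFun]
    abel
  rw [e]
  refine h1.congr_fun fun n => ?_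
  simp [hg, smul_sub]

section Range

variable {T : H →L[ℂ] H}

/-- The partial inner products telescope to `-⟨T*ᴺ x, s_N⟩`, where the states `s_N` stay bounded and
`T*ᴺ x → 0`. -/
lemma observability_mem_modelSpace (hT : ‖T‖ ≤ 1) (hT' : ‖T†‖ ≤ 1)
    (h0 : ∀ x : H, Filter.Tendsto (fun n : ℕ => ((T†) ^ n) x) Filter.atTop (𝓝 0))
    (x : H) : observability (T†) hT' h0 x ∈ modelSpace T := by
  rw [Submodule.mem_orthogonal']
  rintro _ ⟨f, rfl⟩
  obtain ⟨hb, hc⟩ := mulOp_charFun_apply hT f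
  set s := stateSeq T fun n => (f n : H) with hs
  have key : ∀ N, ∑ n ∈ Finset.range N, inner ℂ (observability (T†) hT' h0 x n)
      (mulOp (charFun T) (isMultiplier_charFun T) f n) = - inner ℂ (((T†) ^ N) x) (s N) := by
    intro N
    induction N with
    | zero => simp [hs, stateSeq]
    | succ N ih =>
      have e1 : s (N + 1) = (T†) (s N) + defectOp T (f N) := rfl
      have e2 : ((T†) ^ (N + 1)) x = (T†) (((T†) ^ N) x) := by rw [pow_succ']; rfl
      have e3 := defectOp_defectOp hT' (s N)
      rw [ContinuousLinearMap.adjoint_adjoint] at e3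
      have e4 : T (defectOp T (f N)) = defectOp (T†) (T (f N)) :=
        DFunLike.congr_fun (mul_defectOp T) _
      rw [Finset.sum_range_succ, ih, observability_apply,
        inner_defectMap, hc, map_sub, e3, e1,
        e2, ContinuousLinearMap.adjoint_inner_left, map_add, e4]
      simp only [inner_add_right, inner_sub_right]
      ring
  have h1 := (Hardy.hasSum_inner (observability (T†) hT' h0 x)
    (mulOp (charFun T) (isMultiplier_charFun T) f)).tendsto_sum_nat
  refine tendsto_nhds_unique h1 ?_
  simp only [key]
  refine squeeze_zero_norm (a := fun N => ‖((T†) ^ N) x‖ * ‖f‖) (fun N => ?_) ?_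
  · rw [norm_neg]
    exact (norm_inner_le_norm _ _).trans (mul_le_mul_of_nonneg_left (hb N) (norm_nonneg _))
  · simpa using (h0 x).norm.mul_const ‖f‖

/-- The input `zᵏ ξ` leaves the state at zero through time `k`, outputs `-T ξ` at time `k`, and from
time `k + 1` on outputs the coefficients of `W (D_T ξ)`. -/
lemma inner_mulOp_charFun_single (hT : ‖T‖ ≤ 1) (hT' : ‖T†‖ ≤ 1)
    (h0 : ∀ x : H, Filter.Tendsto (fun n : ℕ => ((T†) ^ n) x) Filter.atTop (𝓝 0))
    (k : ℕ) (ξ : defectSpace T) (g : Hardy (defectSpace (T†))) :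
    inner ℂ (mulOp (charFun T) (isMultiplier_charFun T) (lp.single 2 k ξ)) g
      = inner ℂ (observability (T†) hT' h0 (defectOp T ξ)) (g.drop (k + 1))
        - inner ℂ (T ξ) (g k : H) := by
  obtain ⟨-, hc⟩ := mulOp_charFun_apply hT (lp.single 2 k ξ)
  set f : Hardy (defectSpace T) := lp.single 2 k ξ with hf
  have fk : f k = ξ := by simp [hf]
  have fne : ∀ n, n ≠ k → f n = 0 := fun n hn => by simp [hf, hn]
  set s := stateSeq T fun n => (f n : H) with hs
  have s1 : ∀ n, n ≤ k → s n = 0 := by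
    intro n
    induction n with
    | zero => intro _; rfl
    | succ n ih =>
      intro hn
      change (T†) (s n) + defectOp T (f n) = 0
      rw [ih (by omega), fne n (by omega)]
      simp
  have s2 : ∀ m, s (m + (k + 1)) = ((T†) ^ m) (defectOp T ξ) := by
    intro m
    induction m with
    | zero =>
      rw [zero_add]
      change (T†) (s k) + defectOp T (f k) = _
      rw [s1 k le_rfl, fk]
      simp
    | succ m ih =>
      rw [Nat.add_right_comm]
      change (T†) (s (m + (k + 1))) + defectOp T (f (m + (k + 1))) = _
      rw [ih, fne _ (by omega), pow_succ']
      simp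
  set G := mulOp (charFun T) (isMultiplier_charFun T) f
  have hdrop : G.drop (k + 1) = observability (T†) hT' h0 (defectOp T ξ) := by
    ext m
    rw [Hardy.drop_apply, hc, s2, fne _ (by omega), observability_apply, coe_defectMap]
    simp
  have h1 := (hasSum_nat_add_iff (f := fun n => inner ℂ (G n) (g n)) (k + 1)).1
    (Hardy.hasSum_inner (G.drop (k + 1)) (g.drop (k + 1)))
  rw [(Hardy.hasSum_inner G g).unique h1, hdrop, Finset.sum_range_succ, Finset.sum_eq_zero]
  · rw [zero_add, sub_eq_add_neg, Submodule.coe_inner, hc, s1 k le_rfl, fk]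
    simp
  · intro n hn
    have hn' := Finset.mem_range.1 hn
    rw [Submodule.coe_inner, hc, s1 n hn'.le, fne n hn'.ne]
    simp

/-- With `h k = W* (g.drop k)`, the relations `r1` and `r2` say that the inverse of the unitary
colligation takes `(h (k+1), g k)` to `(h k, 0)`. Running the colligation forward from `(h k, 0)`
gives `r3` and `r4`, so `g = W (h 0)`. -/
lemma exists_observability_eq (hT : ‖T‖ ≤ 1) (hT' : ‖T†‖ ≤ 1)
    (h0 : ∀ x : H, Filter.Tendsto (fun n : ℕ => ((T†) ^ n) x) Filter.atTop (𝓝 0))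
    {g : Hardy (defectSpace (T†))} (hg : g ∈ modelSpace T) :
    ∃ x, observability (T†) hT' h0 x = g := by
  set W := observability (T†) hT' h0
  set V := (W.toContinuousLinearMap)†
  have hVi : ∀ (a : Hardy (defectSpace (T†))) (y : H), inner ℂ y (V a) = inner ℂ (W y) a :=
    fun a y => ContinuousLinearMap.adjoint_inner_right W.toContinuousLinearMap y a
  obtain ⟨h, hh⟩ : ∃ h : ℕ → H, ∀ k, h k = V (g.drop k) := ⟨_, fun _ => rfl⟩
  have r1 : ∀ k, h k = defectOp (T†) (g k) + T (h (k + 1)) := by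
    intro k
    refine ext_inner_left ℂ fun y => ?_
    have hdrop : (g.drop k).drop 1 = g.drop (k + 1) := by
      ext n
      simp [add_assoc, add_comm 1 k]
    have e1 : inner ℂ y (T (h (k + 1))) = inner ℂ (W ((T†) y)) (g.drop (k + 1)) := by
      rw [← ContinuousLinearMap.adjoint_inner_left, hh, hVi]
    rw [inner_add_right, e1, hh, hVi, Hardy.inner_eq_add_drop, observability_drop_one, hdrop,
      ← inner_defectMap, Hardy.drop_apply, zero_add, observability_apply_zero]
  have r2 : ∀ k, defectOp T (h (k + 1)) = (T†) (g k) := by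
    intro k
    -- Orthogonality to `M_Θ (zᵏ ξ)` is tested with `ξ = d`, the difference that has to vanish; it
    -- yields `⟨d, d⟩ = 0`.
    let d : defectSpace T := defectMap T (h (k + 1))
      - ⟨(T†) (g k), adjoint_map_defectSpace T (g k).2⟩
    have hd : (d : H) = defectOp T (h (k + 1)) - (T†) (g k) := rfl
    have h1 := (Submodule.mem_orthogonal _ _).1 hg _ ⟨lp.single 2 k d, rfl⟩
    have h2 : inner ℂ (d : H) (d : H) = 0 := by
      have h3 := inner_mulOp_charFun_single hT hT' h0 k d g
      rw [h1, ← hVi, ← hh, ← ContinuousLinearMap.adjoint_inner_right T, inner_defectOp,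
        ← inner_sub_right] at h3
      exact h3.symm
    rw [← sub_eq_zero, ← hd]
    exact inner_self_eq_zero.1 h2
  have r3 : ∀ k, h (k + 1) = (T†) (h k) := by
    intro k
    rw [r1 k, map_add, adjoint_defectOp, ← r2, defectOp_defectOp hT]
    abel
  have r4 : ∀ k, (g k : H) = defectOp (T†) (h k) := by
    intro k
    have e1 := defectOp_defectOp hT' (g k : H)
    rw [ContinuousLinearMap.adjoint_adjoint] at e1
    have e2 : T (defectOp T (h (k + 1))) = defectOp (T†) (T (h (k + 1))) :=
      DFunLike.congr_fun (mul_defectOp T) _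
    rw [r1 k, map_add, e1, ← e2, r2]
    abel
  have r5 : ∀ k, h k = ((T†) ^ k) (h 0) := by
    intro k
    induction k with
    | zero => simp
    | succ k ih => rw [r3, ih, pow_succ']; rfl
  refine ⟨h 0, ?_⟩
  ext k
  rw [r4, r5 k]
  rfl

/-- The canonical isometry as a unitary onto the model space. -/
def modelUnitary (hT : ‖T‖ ≤ 1) (hT' : ‖T†‖ ≤ 1)
    (h0 : ∀ x : H, Filter.Tendsto (fun n : ℕ => ((T†) ^ n) x) Filter.atTop (𝓝 0)) :
    H ≃ₗᵢ[ℂ] modelSpace T :=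
  LinearIsometryEquiv.ofSurjective
    { toLinearMap := (observability (T†) hT' h0).toLinearMap.codRestrict (modelSpace T)
        (observability_mem_modelSpace hT hT' h0)
      norm_map' := (observability (T†) hT' h0).norm_map }
    fun g => by
      obtain ⟨x, hx⟩ := exists_observability_eq hT hT' h0 g.2
      exact ⟨x, Subtype.ext hx⟩

/-- If `D B* = A₁ D + A₂* D T*` with `D = D_{T*}`, then the canonical unitary carries `B` to the
compression of `I ⊗ A₁* + M_z ⊗ A₂`. -/
lemma modelUnitary_map_eq_compression (hT : ‖T‖ ≤ 1) (hT' : ‖T†‖ ≤ 1)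
    (h0 : ∀ x : H, Filter.Tendsto (fun n : ℕ => ((T†) ^ n) x) Filter.atTop (𝓝 0))
    {A₁ A₂ : defectSpace (T†) →L[ℂ] defectSpace (T†)}
    {B : H →L[ℂ] H} (hB : Commute (B†) (T†))
    (h : ∀ x, defectMap (T†) ((B†) x)
      = A₁ (defectMap (T†) x) + (A₂†) (defectMap (T†) ((T†) x))) (x : H) :
    modelUnitary hT hT' h0 (B x)
      = compression (modelSpace T) (idTensor (A₁†) + shiftTensor A₂)
          (modelUnitary hT hT' h0 x) := by
  refine map_eq_compression (modelSpace T) _ (modelUnitary hT hT' h0) (fun x y => ?_) x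
  -- The chain is `⟨W y, (I ⊗ A₁* + M_z ⊗ A₂) W x⟩ = ⟨W B* y, W x⟩ = ⟨B* y, x⟩ = ⟨y, B x⟩`.
  exact ((inner_observability_pencil (hS := hT') (h0 := h0) hB h y
    (observability (T†) hT' h0 x)).trans
    ((observability (T†) hT' h0).inner_map_map ((B†) y) x)).trans
    (ContinuousLinearMap.adjoint_inner_left B x y)

end Range

end Model

lemma commute_adjoint {H : Type u} [NormedAddCommGroup H] [InnerProductSpace ℂ H]
    [CompleteSpace H] {A B : H →L[ℂ] H} (h : Commute A B) : Commute (A†) (B†) := by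
  simpa [ContinuousLinearMap.star_eq_adjoint] using h.star_star

end Tetrablock

end

/-! ### The functional model -/

theorem theorem3p4 {H : Type*} [NormedAddCommGroup H] [InnerProductSpace ℂ H] [CompleteSpace H]
    (T₁ T₂ T : H →L[ℂ] H) (hT : IsPureEContraction T₁ T₂ T)
    (A₁ A₂ : defectSpace (T†) →L[ℂ] defectSpace (T†))
    (hA : IsFundamentalPair (T₁†) (T₂†) (T†) A₁ A₂)
    (hcomm : A₁ * A₂ = A₂ * A₁)
    (hstar : A₁† * A₁ - A₁ * A₁† = A₂† * A₂ - A₂ * A₂†) :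
    TripleUnitarilyEquivalent T₁ T₂ T
      (compression (modelSpace T) (idTensor (A₁†) + shiftTensor A₂))
      (compression (modelSpace T) (idTensor (A₂†) + shiftTensor A₁))
      (compression (modelSpace T)
        (shiftTensor (ContinuousLinearMap.id ℂ (defectSpace (T†))))) := by
  have h1 : ‖T‖ ≤ 1 := hT.toIsEContraction.norm_le_one
  have h1' : ‖T†‖ ≤ 1 := by rwa [LinearIsometryEquiv.norm_map]
  refine ⟨modelUnitary h1 h1' hT.tendsto_adjoint_pow, ?_, ?_, ?_⟩
  · have c := commute_adjoint hT.commute₁₃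
    exact modelUnitary_map_eq_compression h1 h1' _ c (hA.defectMap_apply c h1')
  · have c := commute_adjoint hT.commute₂₃
    exact modelUnitary_map_eq_compression h1 h1' _ c (hA.symm.defectMap_apply c h1')
  -- `M_z ⊗ I` is the pencil of the pair `(0, I)`, for which the required relation is the identity
  -- `D T* = D T*`.
  · have hz : idTensor ((0 : defectSpace (T†) →L[ℂ] defectSpace (T†))†)
        + shiftTensor (ContinuousLinearMap.id ℂ (defectSpace (T†)))
        = shiftTensor (ContinuousLinearMap.id ℂ (defectSpace (T†))) := by
      ext f n
      simp [idTensor_apply]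
    intro x
    refine (modelUnitary_map_eq_compression h1 h1' _ (A₁ := 0)
      (A₂ := ContinuousLinearMap.id ℂ (defectSpace (T†))) (Commute.refl _)
      (fun x => by simp [ContinuousLinearMap.adjoint_id]) x).trans ?_
    exact congrArg (fun M => compression (modelSpace T) M _) hz
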